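/- Let $\kappa$ be an infinite cardinal with $\kappa=\kappa^{\omega}$, let $\mathbb T=\mathbb R/\mathbb Z$, and let $G=\mathbb Q^{(\kappa)}$ be the group of all finitely supported functions $\kappa\to\mathbb Q$, where $\kappa$ is regarded as the set of ordinals below it. For $\mu\in\kappa$ let $\chi_\mu\in G$ be the function with value $1$ at $\mu$ and $0$ elsewhere, and let $\chi_{\vec\mu}\in G^\omega$ be the constant sequence with value $\chi_\mu$. Let $(f_\xi:\omega\le\xi<\kappa)$ be an enumeration of $G^\omega$ (possibly with repetitions) such that $\bigcup_{n\in\omega}\operatorname{supp} f_\xi(n)\subseteq\xi$ for every $\xi\in[\omega,\kappa)$. Let $p$ be a selective ultrafilter on $\omega$, i.e. a nonprincipal ultrafilter such that every function $\omega\to\omega$ is constant or one-to-one on some member of $p$. Write $G^\omega/p$ for the ultrapower of $G$ by $p$, a $\mathbb Q$-vector space, and $[g]_p$ for the class of $g\in G^\omega$. Let $I\subseteq[\omega,\kappa)$ be such that the classes $[f_\xi]_p$ ($\xi\in I$) together with the classes $[\chi_{\vec\mu}]_p$ ($\mu\in\kappa$), as an indexed family, form a $\mathbb Q$-basis of $G^\omega/p$.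 Then for every $d\in G\setminus\{0\}$, every finite nonempty $D\subseteq I$, every $r:D\to\mathbb Q\setminus\{0\}$ and every $B\in p$ there is a group homomorphism $\phi:G\to\mathbb T$ such that a) $\phi(d)\neq 0$; b) for every $\xi\in I$ and every integer $N\ge 1$, the sequence $\left(\phi\left(\tfrac1N f_\xi(n)\right)\right)_{n\in\omega}$ has $p$-limit $\phi\left(\tfrac1N\chi_\xi\right)$, i.e. for every neighbourhood $U$ of $\phi\left(\tfrac1N\chi_\xi\right)$ in $\mathbb T$, $\left\{n\in\omega:\phi\left(\tfrac1N f_\xi(n)\right)\in U\right\}\in p$; c) the sequence $\left(\phi\left(\sum_{\mu\in D}r(\mu)f_\mu(n)\right):n\in B\right)$ does not converge in $\mathbb T$. -/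

import Mathlib

open Filter Topology Cardinal

universe u

noncomputable section

/-- A selective (Ramsey) ultrafilter on `ω`: a nonprincipal ultrafilter such that every function
`ω → ω` is constant or one-to-one on some member of it. -/
def IsSelective (p : Ultrafilter ℕ) : Prop :=
  (p : Filter ℕ) ≤ Filter.cofinite ∧
    ∀ g : ℕ → ℕ, ∃ A ∈ p, (∃ c, ∀ n ∈ A, g n = c) ∨ Set.InjOn g A

/-- The cardinal `κ` as the set of ordinals below its initial ordinal. -/
abbrev Idx (κ : Cardinal.{u}) : Type (u + 1) := Set.Iio κ.ord

/-- `G = ℚ^(κ)`: the finitely supported functions from `κ` to `ℚ`. -/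
abbrev DirectSumQ (κ : Cardinal.{u}) : Type (u + 1) := Idx κ →₀ ℚ

/-- `χ_μ`: the element of `ℚ^(κ)` with support `{μ}` and value `1` at `μ`. -/
def chi {κ : Cardinal.{u}} (μ : Idx κ) : DirectSumQ κ := Finsupp.single μ 1

/-- The ultrapower `G^ω / p`, with Mathlib's `ℚ`-vector space structure on germs. -/
abbrev Ultrapower (κ : Cardinal.{u}) (p : Ultrafilter ℕ) : Type (u + 1) :=
  Filter.Germ (p : Filter ℕ) (DirectSumQ κ)

/-- The class `[g]_p` of a sequence `g ∈ G^ω`. -/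
def cls {κ : Cardinal.{u}} (p : Ultrafilter ℕ) (g : ℕ → DirectSumQ κ) : Ultrapower κ p :=
  (g : Filter.Germ (p : Filter ℕ) (DirectSumQ κ))

/-- The family consisting of the classes `[f_ξ]_p` for `ξ ∈ I` and the classes of the constant
sequences with value `χ_μ` for `μ ∈ κ`. -/
def basisFamily {κ : Cardinal.{u}} (p : Ultrafilter ℕ) (f : Idx κ → ℕ → DirectSumQ κ)
    (I : Set (Idx κ)) : I ⊕ Idx κ → Ultrapower κ p :=
  Sum.elim (fun ξ => cls p (f ξ)) (fun μ => cls p (fun _ => chi μ))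

/-- `f` restricted to `[ω, κ)` is an enumeration of `G^ω`, and all the supports of the terms of
`f_ξ` are contained in `ξ` for `ω ≤ ξ < κ`. (The values of `f` below `ω` play no role.) -/
def IsGoodEnumeration {κ : Cardinal.{u}} (f : Idx κ → ℕ → DirectSumQ κ) : Prop :=
  (∀ g : ℕ → DirectSumQ κ, ∃ ξ : Idx κ, Ordinal.omega0 ≤ ξ.1 ∧ f ξ = g) ∧
    ∀ ξ : Idx κ, Ordinal.omega0 ≤ ξ.1 → ∀ n : ℕ, ∀ μ ∈ (f ξ n).support, μ < ξ

end

/-!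
The character `φ` is built on countably many coordinates and then extended to all of them.

Let `E` be a countable set of coordinates that contains the supports of `d` and of the `χ μ`,
`μ ∈ D`, and with `ξ` the supports of all `f ξ n`. If `φ` is known on `ℚ^(E)`, transfinite
recursion extends it: since `f ξ` only involves coordinates below `ξ`, for `ξ ∈ I \ E` one may put
`φ (q • χ ξ) = p-lim φ (q • f ξ n)`, and the limit exists because the circle is compact
(`exists_addMonoidHom_extension`).

For the countably many `ξ ∈ I ∩ E` one works in the compact space of all characters of `G` with
the topology of pointwise convergence. The essential point is a density statement: for every
nonempty open set `U` of characters, and finitely many `ξ`, for `p`-almost all `n` some character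
in `U` is almost zero at all `(1 / N) • (f ξ n - χ ξ)`. Independence of the classes `[f ξ]` and
`[χ μ]` says that a nontrivial integer combination of these sequences is not constant modulo `p`,
so for `p`-almost all `n` no relation with small coefficients restricts the values of a
character (`CharSpace.eventually_exists_norm_sub_lt`), and a quantitative Kronecker theorem
(`exists_addMonoidHom_norm_sub_lt`) produces the character. The Kronecker theorem itself is
obtained by averaging powers of `∏ (1 + e(x i)) / 2` over a finite cyclic group of characters.

A Baire category argument now shrinks open sets, using one index `n` at each step to come closer to
the limit conditions. The indices used must form a member of `p`, although the set of indices
admissible at a step depends on the earlier steps. For a selective ultrafilter this is possible: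
a strategy in the ultrafilter game cannot prevent the picks from forming a member of `p`
(`IsSelective.exists_strategyRun`, `IsSelective.exists_forall_eventually_mem`). By the same density
statement, the characters that at some late `b ∈ B` move `∑ r μ • (f μ b - χ μ)` away from `0` form
a dense open set; so the limit character can be taken in all of these sets. Then the sequence in the
last assertion cannot converge along `B`, as its limit would be its limit along `p`.
-/

/-! ### A quantitative Kronecker theorem -/

/-- Finitely many nonzero vectors are simultaneously killed by the average over a finite cyclic
group of characters. -/
lemma exists_cyclic_characters_sum_eq_zero {V : Type*} [AddCommGroup V] [Module ℚ V]
    (F : Finset V) :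
    ∃ L : ℕ, 0 < L ∧ ∃ ψ : V →+ UnitAddCircle, ∀ v ∈ F, v ≠ 0 →
      ∑ s ∈ Finset.range L, (AddCircle.toCircle (s • ψ v) : ℂ) = 0 := by
  classical
  obtain ⟨y, hy⟩ := Module.exists_dual_forall_apply_ne_zero (K := ℚ)
    (fun v : {v // v ∈ F.erase 0} => (v : V)) (fun v => Finset.ne_of_mem_erase v.2)
  -- `c` rescales `y` so that its values on `F` lie strictly between `-1` and `1`.
  set c : ℚ := 1 + ∑ v ∈ F, |y v| with hc
  have hcpos : 0 < c := by positivity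
  have hlt : ∀ v ∈ F, |y v| < c := fun v hv => by
    have := Finset.single_le_sum (f := fun v => |y v|) (fun i _ => abs_nonneg _) hv
    rw [hc]
    linarith
  set L : ℕ := ∏ v ∈ F, (y v / c).den with hL
  refine ⟨L, Finset.prod_pos fun v _ => Rat.den_pos _,
    ((QuotientAddGroup.mk' (AddSubgroup.zmultiples (1 : ℝ))).comp
      (Rat.castHom ℝ).toAddMonoidHom).comp ((AddMonoidHom.mulRight c⁻¹).comp y.toAddMonoidHom), ?_⟩
  intro v hv hv0
  have hyv : y v ≠ 0 := hy ⟨v, Finset.mem_erase.2 ⟨hv0, hv⟩⟩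
  have hval : (((QuotientAddGroup.mk' (AddSubgroup.zmultiples (1 : ℝ))).comp
      (Rat.castHom ℝ).toAddMonoidHom).comp ((AddMonoidHom.mulRight c⁻¹).comp y.toAddMonoidHom)) v
      = (((y v / c : ℚ) : ℝ) : UnitAddCircle) := by
    simp [div_eq_mul_inv]
  simp only [AddCircle.toCircle_nsmul, Circle.coe_pow]
  rw [hval]
  set z : UnitAddCircle := (((y v / c : ℚ) : ℝ) : UnitAddCircle) with hz
  have hz0 : z ≠ 0 := by
    intro h
    obtain ⟨n, hn⟩ := AddCircle.coe_eq_zero_iff (1 : ℝ) |>.1 h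
    have hn' : (n : ℚ) = y v / c := by
      have : ((n : ℚ) : ℝ) = ((y v / c : ℚ) : ℝ) := by simpa using hn
      exact_mod_cast this
    have h1 : |(n : ℚ)| < 1 := by
      rw [hn', abs_div, abs_of_pos hcpos, div_lt_one hcpos]
      exact hlt v hv
    have h2 : n = 0 := by
      rw [← Int.abs_lt_one_iff]
      exact_mod_cast h1
    rw [h2] at hn'
    exact div_ne_zero hyv hcpos.ne' (by simpa using hn'.symm)
  have hLz : L • z = 0 := by
    obtain ⟨k, hk⟩ := Finset.dvd_prod_of_mem (fun v => (y v / c).den) hv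
    rw [hL, hk, mul_comm, mul_smul]
    have : (y v / c).den • z = 0 := by
      rw [hz, ← AddCircle.coe_nsmul, AddCircle.coe_eq_zero_iff]
      refine ⟨(y v / c).num, ?_⟩
      have h3 : (((y v / c).den * (y v / c) : ℚ) : ℝ) = ((y v / c).num : ℝ) := by
        rw [Rat.den_mul_eq_num]
        simp
      rw [nsmul_eq_mul, zsmul_eq_mul, mul_one, ← h3]
      push_cast
      ring
    rw [this, smul_zero]
  have h1 : (AddCircle.toCircle z : ℂ) - 1 ≠ 0 := by
    rw [sub_ne_zero]
    intro h
    apply hz0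
    apply AddCircle.injective_toCircle (T := 1) one_ne_zero
    rw [AddCircle.toCircle_zero]
    exact Circle.ext (by simpa using h)
  have h2 := geom_sum_mul (AddCircle.toCircle z : ℂ) L
  rw [← Circle.coe_pow, ← AddCircle.toCircle_nsmul, hLz] at h2
  simpa [h1] using h2

lemma norm_one_add_div_two_lt_one {z : ℂ} (hz : ‖z‖ = 1) (hz1 : z ≠ 1) : ‖(1 + z) / 2‖ < 1 := by
  have h : ‖1 + z‖ < ‖(1 : ℂ)‖ + ‖z‖ := by
    refine norm_add_lt_of_not_sameRay ?_
    rw [sameRay_iff_norm_smul_eq]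
    simpa [hz] using hz1
  rw [norm_div]
  norm_num [hz] at h ⊢
  linarith

/-- Away from `0` the trigonometric polynomial `(1 + e(x)) / 2` is uniformly smaller than `1`. -/
lemma exists_norm_one_add_toCircle_le {ε : ℝ} (hε : 0 < ε) :
    ∃ q : ℝ, 0 ≤ q ∧ q < 1 ∧
      ∀ x : UnitAddCircle, ε ≤ ‖x‖ → ‖(1 + (AddCircle.toCircle x : ℂ)) / 2‖ ≤ q := by
  have hcont : Continuous fun x : UnitAddCircle => ‖(1 + (AddCircle.toCircle x : ℂ)) / 2‖ := by
    have := AddCircle.continuous_toCircle (T := 1)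
    fun_prop
  have hK : IsCompact {x : UnitAddCircle | ε ≤ ‖x‖} :=
    (isClosed_le continuous_const continuous_norm).isCompact
  rcases Set.eq_empty_or_nonempty {x : UnitAddCircle | ε ≤ ‖x‖} with h | h
  · exact ⟨0, le_rfl, one_pos, fun x hx => absurd hx (Set.eq_empty_iff_forall_notMem.1 h x)⟩
  · obtain ⟨x₀, hx₀, hmax⟩ := hK.exists_isMaxOn h hcont.continuousOn
    refine ⟨_, norm_nonneg _, norm_one_add_div_two_lt_one (Circle.norm_coe _) ?_,
      fun x hx => hmax hx⟩
    intro h1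
    have : x₀ = 0 := by
      apply AddCircle.injective_toCircle (T := 1) one_ne_zero
      rw [AddCircle.toCircle_zero]
      exact Circle.ext (by simpa using h1)
    rw [this, Set.mem_ofPred_eq, norm_zero] at hx₀
    exact absurd hx₀ (not_le.2 hε)

lemma toCircle_sum_coe {ι : Type*} (s : Finset ι) (x : ι → UnitAddCircle) :
    (AddCircle.toCircle (∑ i ∈ s, x i) : ℂ) = ∏ i ∈ s, (AddCircle.toCircle (x i) : ℂ) := by
  classical
  induction s using Finset.induction_on with
  | empty => simp
  | insert i s hi ih => rw [Finset.sum_insert hi, Finset.prod_insert hi, AddCircle.toCircle_add,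
      Circle.coe_mul, ih]

/-- Binomial expansion of the product of the `R`-th powers of `(1 + e(x i)) / 2`. -/
lemma prod_one_add_toCircle_div_two_pow {ι : Type*} [Fintype ι] [DecidableEq ι] (R : ℕ)
    (x : ι → UnitAddCircle) :
    ∏ i, ((1 + (AddCircle.toCircle (x i) : ℂ)) / 2) ^ R =
      ∑ a ∈ Fintype.piFinset fun _ : ι => Finset.range (R + 1),
        ((∏ i, ((R.choose (a i) : ℝ) / 2 ^ R) : ℝ) : ℂ) *
          (AddCircle.toCircle (∑ i, a i • x i) : ℂ) := by
  have h : ∀ i, ((1 + (AddCircle.toCircle (x i) : ℂ)) / 2) ^ R =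
      ∑ k ∈ Finset.range (R + 1), (((R.choose k : ℝ) / 2 ^ R : ℝ) : ℂ) *
        (AddCircle.toCircle (k • x i) : ℂ) := by
    intro i
    rw [div_pow, add_comm, add_pow, Finset.sum_div]
    refine Finset.sum_congr rfl fun k _ => ?_
    rw [AddCircle.toCircle_nsmul, Circle.coe_pow]
    push_cast
    ring
  rw [Finset.prod_congr rfl fun i _ => h i, Finset.prod_univ_sum]
  refine Finset.sum_congr rfl fun a _ => ?_
  rw [Finset.prod_mul_distrib, toCircle_sum_coe]
  push_cast
  rfl

/-- A quantitative form of Kronecker's theorem. To solve `φ (v i) ≈ t i` up to `ε` by a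
character `φ` of a rational vector space, it is enough that the `t i` satisfy those integer
relations between the `v i` whose coefficients are bounded by a constant `R` depending only on
`ε` and on the number of the conditions. -/
theorem exists_addMonoidHom_norm_sub_lt {ι : Type*} [Fintype ι] {ε : ℝ} (hε : 0 < ε) :
    ∃ R : ℕ, ∀ {V : Type u} [AddCommGroup V] [Module ℚ V] (v : ι → V) (t : ι → UnitAddCircle),
      (∀ a : ι → ℤ, (∀ i, |a i| ≤ R) → ∑ i, a i • v i = 0 → ∑ i, a i • t i = 0) →
      ∃ φ : V →+ UnitAddCircle, ∀ i, ‖φ (v i) - t i‖ < ε := by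
  classical
  obtain ⟨q, hq0, hq1, hq⟩ := exists_norm_one_add_toCircle_le hε
  obtain ⟨R, hR⟩ : ∃ R : ℕ, ((R + 1 : ℕ) : ℝ) ^ Fintype.card ι * q ^ R < 1 := by
    have h1 : Tendsto (fun n : ℕ => (n : ℝ) ^ Fintype.card ι * q ^ n) atTop (𝓝 0) :=
      tendsto_pow_const_mul_const_pow_of_abs_lt_one _ (by rwa [abs_of_nonneg hq0])
    rcases hq0.eq_or_lt with h0 | h0
    · exact ⟨1, by simp [← h0]⟩
    · obtain ⟨n, hn⟩ := ((h1.eventually (gt_mem_nhds h0)).and (eventually_ge_atTop 1)).exists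
      obtain ⟨m, rfl⟩ : ∃ m, n = m + 1 := ⟨n - 1, by omega⟩
      refine ⟨m, ?_⟩
      have h2 := hn.1
      rw [pow_succ, ← mul_assoc] at h2
      by_contra h3
      push Not at h3
      nlinarith
  refine ⟨R, fun {V} _ _ v t hrel => ?_⟩
  by_contra! hcon
  set S := Fintype.piFinset fun _ : ι => Finset.range (R + 1) with hS
  set w : (ι → ℕ) → V := fun a => ∑ i, a i • v i with hw
  set τ : (ι → ℕ) → UnitAddCircle := fun a => ∑ i, a i • t i with hτ
  set c : (ι → ℕ) → ℝ := fun a => ∏ i, ((R.choose (a i) : ℝ) / 2 ^ R) with hc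
  have hc0 : ∀ a, 0 ≤ c a := fun a => Finset.prod_nonneg fun i _ => by positivity
  have hcsum : ∑ a ∈ S, c a = 1 := by
    have := prod_one_add_toCircle_div_two_pow R (fun _ : ι => (0 : UnitAddCircle))
    simp only [AddCircle.toCircle_zero, smul_zero, Finset.sum_const_zero, Circle.coe_one,
      mul_one] at this
    rw [Finset.prod_congr rfl (fun i _ => (show ((1 + (1 : ℂ)) / 2) ^ R = 1 by norm_num)),
      Finset.prod_const_one, ← hS] at this
    have h2 : ((∑ a ∈ S, c a : ℝ) : ℂ) = 1 := by
      rw [this, Complex.ofReal_sum]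
    exact_mod_cast h2
  have hexp : ∀ φ : V →+ UnitAddCircle,
      ∏ i, ((1 + (AddCircle.toCircle (φ (v i) - t i) : ℂ)) / 2) ^ R =
        ∑ a ∈ S, (c a : ℂ) * (AddCircle.toCircle (φ (w a) - τ a) : ℂ) := by
    intro φ
    rw [prod_one_add_toCircle_div_two_pow]
    refine Finset.sum_congr rfl fun a _ => ?_
    simp only [hw, hτ, smul_sub, Finset.sum_sub_distrib, map_sum, map_nsmul, hc]
  have hle : ∀ φ : V →+ UnitAddCircle,
      ‖∏ i, ((1 + (AddCircle.toCircle (φ (v i) - t i) : ℂ)) / 2) ^ R‖ ≤ q ^ R := by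
    intro φ
    obtain ⟨j, hj⟩ := hcon φ
    rw [norm_prod, ← Finset.mul_prod_erase _ _ (Finset.mem_univ j)]
    have h1 : ∏ i ∈ Finset.univ.erase j,
        ‖((1 + (AddCircle.toCircle (φ (v i) - t i) : ℂ)) / 2) ^ R‖ ≤ 1 := by
      refine Finset.prod_le_one (fun i _ => norm_nonneg _) fun i _ => ?_
      rw [norm_pow]
      refine pow_le_one₀ (norm_nonneg _) ?_
      rw [norm_div, Complex.norm_two, div_le_one two_pos]
      refine (norm_add_le _ _).trans ?_
      rw [Circle.norm_coe, norm_one]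
      norm_num
    have h2 : ‖((1 + (AddCircle.toCircle (φ (v j) - t j) : ℂ)) / 2) ^ R‖ ≤ q ^ R := by
      rw [norm_pow]
      exact pow_le_pow_left₀ (norm_nonneg _) (hq _ hj) _
    calc _ ≤ q ^ R * 1 := mul_le_mul h2 h1 (Finset.prod_nonneg fun i _ => norm_nonneg _)
            (pow_nonneg hq0 _)
      _ = q ^ R := mul_one _
  -- Averaging the expansion against the phase of the monomial `b` isolates the monomials
  -- with the same frequency as `b`, and these all have the same phase.
  have hcoef : ∀ b ∈ S, c b ≤ q ^ R := by
    intro b hb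
    obtain ⟨L, hL, ψ, hψ⟩ := exists_cyclic_characters_sum_eq_zero (S.image fun a => w a - w b)
    obtain ⟨Φ, hΦ⟩ : ∃ Φ : ℕ → V →+ UnitAddCircle, ∀ s x, Φ s x = s • ψ x :=
      ⟨fun s => s • ψ, fun _ _ => rfl⟩
    have havg : ∑ s ∈ Finset.range L,
        (∏ i, ((1 + (AddCircle.toCircle (Φ s (v i) - t i) : ℂ)) / 2) ^ R) *
          (AddCircle.toCircle (τ b - Φ s (w b)) : ℂ) =
        L * ((∑ a ∈ S with w a = w b, c a : ℝ) : ℂ) := by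
      simp_rw [hexp, Finset.sum_mul]
      rw [Finset.sum_comm, Finset.sum_filter]
      push_cast
      rw [Finset.mul_sum]
      refine Finset.sum_congr rfl fun a ha => ?_
      have hterm : ∀ s : ℕ, (c a : ℂ) * (AddCircle.toCircle (Φ s (w a) - τ a) : ℂ) *
          (AddCircle.toCircle (τ b - Φ s (w b)) : ℂ) =
          (c a : ℂ) * (AddCircle.toCircle (τ b - τ a) : ℂ) *
            (AddCircle.toCircle (s • ψ (w a - w b)) : ℂ) := by
        intro s
        rw [mul_assoc, mul_assoc, ← Circle.coe_mul, ← Circle.coe_mul, ← AddCircle.toCircle_add,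
          ← AddCircle.toCircle_add]
        congr 3
        simp only [hΦ, map_sub, smul_sub]
        abel
      simp_rw [hterm]
      rw [← Finset.mul_sum]
      split_ifs with hab
      · have hτab : τ b - τ a = 0 := by
          have h0 := hrel (fun i => (b i : ℤ) - a i) (fun i => by
            have h1 := Finset.mem_range.1 (Fintype.mem_piFinset.1 ha i)
            have h2 := Finset.mem_range.1 (Fintype.mem_piFinset.1 hb i)
            rw [abs_le]
            omega) (by
              simp only [sub_smul, Finset.sum_sub_distrib, natCast_zsmul]
              exact sub_eq_zero.2 hab.symm)
          simpa only [sub_smul, Finset.sum_sub_distrib, natCast_zsmul] using h0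
        rw [hτab, hab]
        simp [mul_comm]
      · rw [hψ _ (Finset.mem_image_of_mem _ ha) (sub_ne_zero.2 hab)]
        simp
    have hnorm : ‖∑ s ∈ Finset.range L,
        (∏ i, ((1 + (AddCircle.toCircle (Φ s (v i) - t i) : ℂ)) / 2) ^ R) *
          (AddCircle.toCircle (τ b - Φ s (w b)) : ℂ)‖ ≤ L * q ^ R := by
      refine (norm_sum_le _ _).trans ?_
      refine (Finset.sum_le_card_nsmul _ _ (q ^ R) fun s _ => ?_).trans (by simp)
      rw [norm_mul, Circle.norm_coe, mul_one]
      exact hle (Φ s)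
    have hpos : 0 ≤ ∑ a ∈ S with w a = w b, c a := Finset.sum_nonneg fun a _ => hc0 a
    rw [havg, norm_mul, Complex.norm_natCast, Complex.norm_real, Real.norm_of_nonneg hpos] at hnorm
    have h3 := le_of_mul_le_mul_left hnorm (by exact_mod_cast hL)
    refine le_trans ?_ h3
    exact Finset.single_le_sum (f := c) (fun a _ => hc0 a) (by simp [hb])
  have hfin := Finset.sum_le_card_nsmul S c (q ^ R) hcoef
  rw [hcsum, hS, Fintype.card_piFinset] at hfin
  simp only [Finset.card_range, Finset.prod_const, Finset.card_univ, nsmul_eq_mul] at hfin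
  push_cast at hfin hR
  linarith

/-! ### Selective ultrafilters and Baire category -/

/-- Diagonal intersections: for a selective ultrafilter, a sequence of members `A m` has a
diagonalizing member `X`. -/
lemma IsSelective.exists_diagonal {p : Ultrafilter ℕ} (hp : IsSelective p) (A : ℕ → Set ℕ)
    (hA : ∀ m, A m ∈ p) : ∃ X ∈ p, ∀ m ∈ X, ∀ n ∈ X, m < n → n ∈ A m := by
  classical
  obtain ⟨hcof, hsel⟩ := hp
  have hfin : ∀ s : Set ℕ, s.Finite → s ∉ p := fun s hs h =>
    Ultrafilter.compl_notMem_iff.2 h (hcof hs.compl_mem_cofinite)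
  by_cases hall : {n | ∀ m, n ∈ A m} ∈ p
  · exact ⟨_, hall, fun m _ n hn _ => hn m⟩
  -- `g n` is the first index `m` at which `n` falls out of `A m`; it is finite-to-one on `Y`.
  have hex : {n | ∃ m, n ∉ A m} ∈ p := by
    have := Ultrafilter.compl_mem_iff_notMem.2 hall
    filter_upwards [this] with n hn
    simpa using hn
  set g : ℕ → ℕ := fun n => sInf {m | n ∉ A m} with hg
  obtain ⟨Y, hY, hYg⟩ := hsel g
  have hinj : Set.InjOn g Y := by
    rcases hYg with ⟨c, hc⟩ | h
    · exfalso
      have h1 : Y ∩ {n | ∃ m, n ∉ A m} ∩ A c ∈ p := inter_mem (inter_mem hY hex) (hA c)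
      obtain ⟨n, ⟨hnY, hn⟩, hnA⟩ := p.nonempty_of_mem h1
      have h2 : g n ∈ {m | n ∉ A m} := Nat.sInf_mem hn
      rw [hc n hnY] at h2
      exact h2 hnA
    · exact h
  have hbound : ∀ k, ∃ N, ∀ n ∈ Y, N ≤ n → ∀ m ≤ k, n ∈ A m := by
    intro k
    have hf : (Y ∩ g ⁻¹' Set.Iic k).Finite :=
      Set.Finite.of_finite_image ((Set.finite_Iic k).subset (by
        rintro _ ⟨n, hn, rfl⟩
        exact hn.2)) (hinj.mono Set.inter_subset_left)
    obtain ⟨N, hN⟩ := hf.bddAbove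
    refine ⟨N + 1, fun n hn hNn m hm => ?_⟩
    by_contra hnm
    have h1 : g n ≤ m := Nat.sInf_le hnm
    have h2 : n ≤ N := hN ⟨hn, h1.trans hm⟩
    omega
  choose h hh using hbound
  -- The block boundaries `b i` grow so fast that `n ∈ A m` as soon as a whole block
  -- separates `m` from `n`.
  set b : ℕ → ℕ := fun i => Nat.rec 0 (fun _ x => max (x + 1) (h x)) i with hb
  have hbs : ∀ i, b (i + 1) = max (b i + 1) (h (b i)) := fun i => rfl
  have hbmono : StrictMono b := strictMono_nat_of_lt_succ fun i => by rw [hbs]; omega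
  set k : ℕ → ℕ := fun n => Nat.findGreatest (fun i => b i ≤ n) n with hk
  have hk1 : ∀ n, b (k n) ≤ n := fun n =>
    Nat.findGreatest_spec (P := fun i => b i ≤ n) (m := 0) (Nat.zero_le _) (Nat.zero_le _)
  have hk2 : ∀ n, n < b (k n + 1) := by
    intro n
    by_contra hcon
    push Not at hcon
    have h1 : k n + 1 ≤ n := (hbmono.id_le _).trans hcon
    have h2 := Nat.le_findGreatest (P := fun i => b i ≤ n) h1 hcon
    have h3 : k n + 1 ≤ k n := h2
    omega
  obtain ⟨Z, hZ, hZk⟩ := hsel k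
  have hinj' : Set.InjOn k Z := by
    rcases hZk with ⟨c, hc⟩ | h'
    · exfalso
      refine hfin Z ((Set.finite_Iio (b (c + 1))).subset fun n hn => ?_) hZ
      have := hk2 n
      rwa [hc n hn] at this
    · exact h'
  -- Passing to blocks of one parity makes any two of them non-adjacent.
  obtain ⟨W, hW, e, hWe⟩ : ∃ W ∈ p, ∃ e, ∀ n ∈ W, k n % 2 = e := by
    rcases p.mem_or_compl_mem {n | k n % 2 = 0} with h' | h'
    · exact ⟨_, h', 0, fun n hn => hn⟩
    · refine ⟨_, h', 1, fun n hn => ?_⟩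
      have : ¬ k n % 2 = 0 := hn
      omega
  refine ⟨Y ∩ Z ∩ W, inter_mem (inter_mem hY hZ) hW, ?_⟩
  rintro m ⟨⟨-, hmZ⟩, hmW⟩ n ⟨⟨hnY, hnZ⟩, hnW⟩ hmn
  have h1 : k m ≠ k n := fun h' => hmn.ne (hinj' hmZ hnZ h')
  have h2 : k m ≤ k n := by
    by_contra hcon
    push Not at hcon
    have h3 : b (k n + 1) ≤ b (k m) := hbmono.monotone hcon
    have := hk2 n
    have := hk1 m
    omega
  have h3 : k m + 2 ≤ k n := by
    have := hWe m hmW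
    have := hWe n hnW
    omega
  refine hh (b (k m + 1)) n hnY ?_ m (hk2 m).le
  calc h (b (k m + 1)) ≤ b (k m + 1 + 1) := by rw [hbs (k m + 1)]; exact le_max_right _ _
    _ ≤ b (k n) := hbmono.monotone h3
    _ ≤ n := hk1 n

/-- The run of a strategy: starting in the state `s₀`, the state changes exactly at the
elements of `X`. -/
noncomputable def strategyRun {σ : Type*} (step : σ → ℕ → σ) (s₀ : σ) (X : Set ℕ) : ℕ → σ
  | 0 => s₀
  | n + 1 => open scoped Classical in
      if n ∈ X then step (strategyRun step s₀ X n) n else strategyRun step s₀ X n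

/-- In the ultrafilter game for a selective ultrafilter `p`, one player offers a member of `p`
depending on the current state and the other picks an element of it; the first player has no
strategy that prevents the set of all picks from being a member of `p`. -/
theorem IsSelective.exists_strategyRun {p : Ultrafilter ℕ} (hp : IsSelective p) {σ : Type*}
    (A : σ → Set ℕ) (hA : ∀ s, A s ∈ p) (step : σ → ℕ → σ) (s₀ : σ) :
    ∃ X ∈ p, ∀ n ∈ X, n ∈ A (strategyRun step s₀ X n) := by
  classical
  -- `R n` contains all the states reachable by picks below `n`.
  set R : ℕ → Set σ := fun n => Nat.rec {s₀} (fun n S => S ∪ (fun s => step s n) '' S) n with hR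
  have hRs : ∀ n, R (n + 1) = R n ∪ (fun s => step s n) '' R n := fun n => rfl
  have hRfin : ∀ n, (R n).Finite := by
    intro n
    induction n with
    | zero => exact Set.finite_singleton s₀
    | succ n ih => rw [hRs]; exact ih.union (ih.image _)
  obtain ⟨X, hX, hXd⟩ := hp.exists_diagonal (fun m => ⋂ s ∈ R (m + 1), A s) fun m =>
    (Filter.biInter_mem (hRfin (m + 1))).2 fun s _ => hA s
  refine ⟨X ∩ A s₀, inter_mem hX (hA s₀), ?_⟩
  have hreach : ∀ n, strategyRun step s₀ (X ∩ A s₀) n ∈ R n := by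
    intro n
    induction n with
    | zero => exact Set.mem_singleton s₀
    | succ n ih =>
      rw [hRs, strategyRun]
      split_ifs
      · exact Or.inr ⟨_, ih, rfl⟩
      · exact Or.inl ih
  have hlast : ∀ n, strategyRun step s₀ (X ∩ A s₀) n = s₀ ∨
      ∃ m ∈ X, m < n ∧ strategyRun step s₀ (X ∩ A s₀) n ∈ R (m + 1) := by
    intro n
    induction n with
    | zero => exact Or.inl rfl
    | succ n ih =>
      by_cases hn : n ∈ X ∩ A s₀
      · exact Or.inr ⟨n, hn.1, n.lt_succ_self, hreach (n + 1)⟩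
      · have heq : strategyRun step s₀ (X ∩ A s₀) (n + 1) =
            strategyRun step s₀ (X ∩ A s₀) n := by
          rw [strategyRun, if_neg hn]
        rw [heq]
        rcases ih with h | ⟨m, hm, hmn, h⟩
        · exact Or.inl h
        · exact Or.inr ⟨m, hm, hmn.trans n.lt_succ_self, h⟩
  intro n hn
  rcases hlast n with h | ⟨m, hm, hmn, h⟩
  · rw [h]
    exact hn.2
  · exact Set.mem_iInter₂.1 (hXd m hm n hn.1 hmn) _ h

/-- Baire category argument along a selective ultrafilter. If every nonempty open set meets
`W k n` for `p`-almost all `n`, then there is a point which lies in `W k n` for `p`-almost all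
`n`, for all `k`, and which moreover lies in prescribed open sets, one nonempty and countably many
dense. -/
theorem IsSelective.exists_forall_eventually_mem {p : Ultrafilter ℕ} (hp : IsSelective p)
    {X : Type*} [TopologicalSpace X] [CompactSpace X] [T2Space X]
    (W : ℕ → ℕ → Set X) (hWo : ∀ k n, IsOpen (W k n)) (hWanti : ∀ n, Antitone fun k => W k n)
    (hW : ∀ k (U : Set X), IsOpen U → U.Nonempty → ∀ᶠ n in (p : Filter ℕ), (U ∩ W k n).Nonempty)
    (V : ℕ → Set X) (hVo : ∀ k, IsOpen (V k)) (hV : ∀ k, Dense (V k))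
    {U₀ : Set X} (hU₀ : IsOpen U₀) (hU₀ne : U₀.Nonempty) :
    ∃ x ∈ U₀, (∀ k, x ∈ V k) ∧ ∀ k, ∀ᶠ n in (p : Filter ℕ), x ∈ W k n := by
  classical
  have hshrink : ∀ O : Set X, IsOpen O → O.Nonempty →
      ∃ O' : Set X, IsOpen O' ∧ O'.Nonempty ∧ closure O' ⊆ O := by
    rintro O hO ⟨x, hx⟩
    obtain ⟨C, hC, hCc, hCO⟩ := exists_mem_nhds_isClosed_subset (hO.mem_nhds hx)
    exact ⟨interior C, isOpen_interior, ⟨x, mem_interior_iff_mem_nhds.2 hC⟩,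
      (closure_minimal interior_subset hCc).trans hCO⟩
  let σ := {O : Set X // IsOpen O ∧ O.Nonempty} × ℕ
  have hstep : ∀ (s : σ) (n : ℕ), ∃ s' : σ, s'.2 = s.2 + 1 ∧ closure s'.1.1 ⊆ s.1.1 ∧
      ((s.1.1 ∩ W s.2 n).Nonempty → closure s'.1.1 ⊆ V s.2 ∩ W s.2 n) := by
    rintro ⟨⟨O, hO, hOne⟩, k⟩ n
    by_cases h : (O ∩ W k n).Nonempty
    · obtain ⟨O', h1, h2, h3⟩ := hshrink (O ∩ W k n ∩ V k) ((hO.inter (hWo k n)).inter (hVo k))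
        ((hV k).inter_open_nonempty _ (hO.inter (hWo k n)) h)
      exact ⟨⟨⟨O', h1, h2⟩, k + 1⟩, rfl, h3.trans fun x hx => hx.1.1,
        fun _ => h3.trans fun x hx => ⟨hx.2, hx.1.2⟩⟩
    · obtain ⟨O', h1, h2, h3⟩ := hshrink O hO hOne
      exact ⟨⟨⟨O', h1, h2⟩, k + 1⟩, rfl, h3, fun h' => absurd h' h⟩
  choose step hstep1 hstep2 hstep3 using hstep
  obtain ⟨O₀, hO₀, hO₀ne, hO₀U⟩ := hshrink U₀ hU₀ hU₀ne
  obtain ⟨Y, hY, hYA⟩ := hp.exists_strategyRun (fun s : σ => {n | (s.1.1 ∩ W s.2 n).Nonempty})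
    (fun s => hW s.2 s.1.1 s.1.2.1 s.1.2.2) step ⟨⟨O₀, hO₀, hO₀ne⟩, 0⟩
  set S := strategyRun step ⟨⟨O₀, hO₀, hO₀ne⟩, 0⟩ Y with hS
  have hSin : ∀ n ∈ Y, S (n + 1) = step (S n) n := fun n hn => by
    rw [hS, strategyRun, if_pos hn]
  have hSout : ∀ n ∉ Y, S (n + 1) = S n := fun n hn => by
    rw [hS, strategyRun, if_neg hn]
  have hanti : ∀ n, closure (S (n + 1)).1.1 ⊆ closure (S n).1.1 := by
    intro n
    by_cases hn : n ∈ Y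
    · rw [hSin n hn]
      exact (hstep2 _ _).trans subset_closure
    · rw [hSout n hn]
  obtain ⟨x, hx⟩ := IsCompact.nonempty_iInter_of_sequence_nonempty_isCompact_isClosed
    (fun n => closure (S n).1.1) hanti (fun n => (S n).1.2.2.closure)
    isClosed_closure.isCompact fun n => isClosed_closure
  rw [Set.mem_iInter] at hx
  have hxmem : ∀ n ∈ Y, x ∈ V (S n).2 ∩ W (S n).2 n := fun n hn => by
    have h1 := hx (n + 1)
    rw [hSin n hn] at h1
    exact hstep3 _ _ (hYA n hn) h1
  have hlevel_mono : Monotone fun n => (S n).2 := by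
    refine monotone_nat_of_le_succ fun n => ?_
    by_cases hn : n ∈ Y
    · rw [hSin n hn, hstep1]
      exact Nat.le_succ _
    · rw [hSout n hn]
  have hYinf : ∀ n, ∃ m ∈ Y, n ≤ m := by
    intro n
    have h1 : Set.Ici n ∈ (p : Filter ℕ) := hp.1 (by
      rw [Nat.cofinite_eq_atTop]
      exact Ici_mem_atTop n)
    obtain ⟨m, hm⟩ := p.nonempty_of_mem (inter_mem hY h1)
    exact ⟨m, hm.1, hm.2⟩
  have hlevel : ∀ k, ∃ n ∈ Y, (S n).2 = k := by
    intro k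
    -- The first time at which the level exceeds `k` comes directly after a pick at level `k`.
    have hex : ∀ k, ∃ n, k ≤ (S n).2 := by
      intro k
      induction k with
      | zero => exact ⟨0, Nat.zero_le _⟩
      | succ k ih =>
        obtain ⟨n, hn⟩ := ih
        obtain ⟨m, hmY, hnm⟩ := hYinf n
        refine ⟨m + 1, ?_⟩
        rw [hSin m hmY, hstep1]
        exact Nat.succ_le_succ (hn.trans (hlevel_mono hnm))
    have h1 := Nat.find_spec (hex (k + 1))
    have h2 := fun m => Nat.find_min (hex (k + 1)) (m := m)
    set N := Nat.find (hex (k + 1))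
    obtain ⟨m, hm⟩ : ∃ m, N = m + 1 := by
      refine Nat.exists_eq_succ_of_ne_zero fun h0 => ?_
      rw [h0] at h1
      have : (S 0).2 = 0 := rfl
      omega
    have h3 := h2 m (by omega)
    rw [hm] at h1
    by_cases hmY : m ∈ Y
    · refine ⟨m, hmY, ?_⟩
      rw [hSin m hmY, hstep1] at h1
      omega
    · rw [hSout m hmY] at h1
      exact absurd h1 h3
  refine ⟨x, hO₀U (hx 0), fun k => ?_, fun k => ?_⟩
  · obtain ⟨n, hn, hk⟩ := hlevel k
    exact hk ▸ (hxmem n hn).1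
  · obtain ⟨n, -, hk⟩ := hlevel k
    have h1 : Set.Ici n ∈ (p : Filter ℕ) := hp.1 (by
      rw [Nat.cofinite_eq_atTop]
      exact Ici_mem_atTop n)
    filter_upwards [hY, h1] with m hmY hnm
    refine hWanti m ?_ (hxmem m hmY).2
    rw [← hk]
    exact hlevel_mono hnm

/-! ### Density in the space of characters -/

/-- The characters `V → ℝ/ℤ` of an abelian group `V`, as a subspace of the product space
`V → ℝ/ℤ`, that is with the topology of pointwise convergence. -/
abbrev CharSpace (V : Type*) [AddCommGroup V] : Type _ :=
  {x : V → UnitAddCircle // ∀ a b, x (a + b) = x a + x b}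

/-- A point of the character space as a homomorphism. -/
def CharSpace.toHom {V : Type*} [AddCommGroup V] (x : CharSpace V) : V →+ UnitAddCircle :=
  AddMonoidHom.mk' x.1 x.2

/-- A homomorphism as a point of the character space. -/
def CharSpace.ofHom {V : Type*} [AddCommGroup V] (φ : V →+ UnitAddCircle) : CharSpace V :=
  ⟨φ, φ.map_add⟩

lemma CharSpace.continuous_toHom_apply {V : Type*} [AddCommGroup V] (v : V) :
    Continuous fun x : CharSpace V => x.toHom v :=
  (continuous_apply v).comp continuous_subtype_val

instance {V : Type*} [AddCommGroup V] : CompactSpace (CharSpace V) := by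
  have h : IsClosed {x : V → UnitAddCircle | ∀ a b, x (a + b) = x a + x b} := by
    simp only [Set.ofPred_forall]
    exact isClosed_iInter fun a => isClosed_iInter fun b =>
      isClosed_eq (by fun_prop) (by fun_prop)
  exact isCompact_iff_compactSpace.1 h.isCompact

lemma exists_addMonoidHom_apply_ne_zero {V : Type*} [AddCommGroup V] [Module ℚ V] {v : V}
    (hv : v ≠ 0) : ∃ φ : V →+ UnitAddCircle, φ v ≠ 0 := by
  obtain ⟨L, hL, ψ, hψ⟩ := exists_cyclic_characters_sum_eq_zero {v}
  refine ⟨ψ, fun h => ?_⟩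
  have := hψ v (Finset.mem_singleton_self v) hv
  simp [h, hL.ne'] at this

/-- Equidistribution along an ultrafilter. If no nontrivial integer combination of the sequences
`g i` is constant modulo `p`, then for `p`-almost all `n` the values at the `g i n` of the
characters in a given nonempty open set come close to arbitrary prescribed values `t i`. -/
theorem CharSpace.eventually_exists_norm_sub_lt {V : Type u} [AddCommGroup V] [Module ℚ V]
    (p : Ultrafilter ℕ) {ι : Type*} [Fintype ι] (g : ι → ℕ → V)
    (hg : ∀ a : ι → ℤ, a ≠ 0 → ∀ c, ∀ᶠ n in (p : Filter ℕ), ∑ i, a i • g i n ≠ c)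
    (t : ι → UnitAddCircle) {ε : ℝ} (hε : 0 < ε) {U : Set (CharSpace V)} (hU : IsOpen U)
    (hne : U.Nonempty) :
    ∀ᶠ n in (p : Filter ℕ), ∃ x ∈ U, ∀ i, ‖x.toHom (g i n) - t i‖ < ε := by
  classical
  obtain ⟨x₀, hx₀⟩ := hne
  obtain ⟨O, hO, rfl⟩ := isOpen_induced_iff.1 hU
  obtain ⟨F, u, hu, hFO⟩ := isOpen_pi_iff.1 hO x₀.1 hx₀
  obtain ⟨δ, hδu, hδ0, hδε⟩ : ∃ δ : ℝ, (∀ v ∈ F, Metric.ball (x₀.1 v) δ ⊆ u v) ∧ 0 < δ ∧ δ < ε := by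
    have h1 : ∀ᶠ δ in 𝓝[>] (0 : ℝ), ∀ v ∈ F, Metric.ball (x₀.1 v) δ ⊆ u v := by
      refine (Filter.eventually_all_finset F).2 fun v hv => ?_
      obtain ⟨r, hr, hru⟩ := Metric.isOpen_iff.1 (hu v hv).1 _ (hu v hv).2
      filter_upwards [Ioo_mem_nhdsGT hr] with δ hδ
      exact (Metric.ball_subset_ball hδ.2.le).trans hru
    obtain ⟨δ, h2, h3⟩ := (h1.and (Ioo_mem_nhdsGT hε)).exists
    exact ⟨δ, h2, h3.1, h3.2⟩
  obtain ⟨R, hR⟩ := exists_addMonoidHom_norm_sub_lt (ι := F ⊕ ι) hδ0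
  -- Only finitely many relations have to be avoided.
  have hev : ∀ᶠ n in (p : Filter ℕ), ∀ a ∈ Fintype.piFinset fun _ : F ⊕ ι =>
      Finset.Icc (-(R : ℤ)) R, (fun i => a (Sum.inr i)) ≠ 0 →
        ∑ i, a (Sum.inr i) • g i n ≠ -∑ v : F, a (Sum.inl v) • (v : V) := by
    refine (Filter.eventually_all_finset _).2 fun a _ => ?_
    by_cases h : (fun i => a (Sum.inr i)) = 0
    · exact Eventually.of_forall fun n h' => absurd h h'
    · filter_upwards [hg _ h (-∑ v : F, a (Sum.inl v) • (v : V))] with n hn _ using hn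
  filter_upwards [hev] with n hn
  obtain ⟨φ, hφ⟩ := hR (Sum.elim (fun v : F => (v : V)) fun i => g i n)
    (Sum.elim (fun v : F => x₀.toHom v) t) (by
      intro a ha hrel
      have ha' : a ∈ Fintype.piFinset fun _ : F ⊕ ι => Finset.Icc (-(R : ℤ)) R :=
        Fintype.mem_piFinset.2 fun i => Finset.mem_Icc.2 (abs_le.1 (ha i))
      simp only [Fintype.sum_sum_type, Sum.elim_inl, Sum.elim_inr] at hrel ⊢
      have h0 : (fun i => a (Sum.inr i)) = 0 := by
        by_contra h
        exact hn a ha' h (eq_neg_of_add_eq_zero_right hrel)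
      have h0' : ∀ i, a (Sum.inr i) = 0 := congrFun h0
      simp only [h0', zero_smul, Finset.sum_const_zero, add_zero] at hrel ⊢
      simp only [← map_zsmul, ← map_sum]
      rw [hrel, map_zero])
  refine ⟨CharSpace.ofHom φ, hFO fun v hv => hδu v hv ?_, fun i => (hφ (Sum.inr i)).trans hδε⟩
  rw [mem_ball_iff_norm]
  exact hφ (Sum.inl ⟨v, hv⟩)

/-! ### The character on countably many coordinates -/

/-- The class map `G^ω → G^ω / p` as a linear map. -/
def clsLinear {κ : Cardinal.{u}} (p : Ultrafilter ℕ) :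
    (ℕ → DirectSumQ κ) →ₗ[ℚ] Ultrapower κ p where
  toFun := cls p
  map_add' _ _ := rfl
  map_smul' _ _ := rfl

lemma cls_const_mem_span {κ : Cardinal.{u}} (p : Ultrafilter ℕ) (c : DirectSumQ κ) :
    cls p (fun _ => c) ∈
      Submodule.span ℚ (Set.range fun μ : Idx κ => cls p (fun _ => chi μ)) := by
  induction c using Finsupp.induction_linear with
  | zero => exact Submodule.zero_mem _
  | add a b ha hb => exact Submodule.add_mem _ ha hb
  | single μ q =>
    have h : cls p (fun _ => Finsupp.single μ q) = q • cls p (fun _ => chi μ) := by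
      have h1 : (fun _ : ℕ => (Finsupp.single μ q : DirectSumQ κ)) = q • fun _ => chi μ := by
        funext _
        simp [chi]
      rw [h1]
      exact (clsLinear p).map_smul q _
    rw [h]
    exact Submodule.smul_mem _ _ (Submodule.subset_span ⟨μ, rfl⟩)

/-- Independence of the basis family, in terms of sequences: a rational combination of the
`f ξ` that is constant modulo `p` is trivial. -/
lemma eq_zero_of_eventually_sum_smul_eq {κ : Cardinal.{u}} {p : Ultrafilter ℕ}
    {f : Idx κ → ℕ → DirectSumQ κ} {I : Set (Idx κ)}
    (hli : LinearIndependent ℚ (basisFamily p f I)) {ι : Type*} [Fintype ι] (e : ι → Idx κ)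
    (he : Function.Injective e) (heI : ∀ i, e i ∈ I) (s : ι → ℚ) (c : DirectSumQ κ)
    (h : ∀ᶠ n in (p : Filter ℕ), ∑ i, s i • f (e i) n = c) : s = 0 := by
  obtain ⟨hl, -, hdisj⟩ := linearIndependent_sum.1 hli
  have hl' : LinearIndependent ℚ fun i => cls p (f (e i)) :=
    hl.comp (fun i => (⟨e i, heI i⟩ : I)) fun i j hij => he (Subtype.ext_iff.1 hij)
  have hsum : ∑ i, s i • cls p (f (e i)) = cls p (fun _ => c) := by
    have h1 : ∑ i, s i • cls p (f (e i)) = clsLinear p (∑ i, s i • f (e i)) := by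
      rw [map_sum]
      exact Finset.sum_congr rfl fun i _ => ((clsLinear p).map_smul _ _).symm
    rw [h1]
    refine Germ.coe_eq.2 ?_
    filter_upwards [h] with n hn
    simpa using hn
  have hzero : cls p (fun _ => c) = 0 := by
    refine Submodule.disjoint_def.1 hdisj _ ?_ (cls_const_mem_span p c)
    rw [← hsum]
    exact Submodule.sum_mem _ fun i _ => Submodule.smul_mem _ _
      (Submodule.subset_span ⟨⟨e i, heI i⟩, rfl⟩)
  rw [hzero] at hsum
  exact funext (Fintype.linearIndependent_iff.1 hl' s hsum)

/-- For `p`-almost all `n`, a given nonempty open set contains a character that satisfies finitely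
many of the limit conditions up to `ε` at the index `n`. -/
lemma eventually_exists_norm_smul_sub_chi_lt {κ : Cardinal.{u}} {p : Ultrafilter ℕ}
    {f : Idx κ → ℕ → DirectSumQ κ} {I : Set (Idx κ)}
    (hli : LinearIndependent ℚ (basisFamily p f I)) {J : Finset (Idx κ)}
    (hJ : ∀ ξ ∈ J, ξ ∈ I) {N : ℚ} (hN : N ≠ 0) {ε : ℝ} (hε : 0 < ε)
    {U : Set (CharSpace (DirectSumQ κ))} (hU : IsOpen U) (hne : U.Nonempty) :
    ∀ᶠ n in (p : Filter ℕ), ∃ x ∈ U, ∀ ξ ∈ J, ‖x.toHom (N • (f ξ n - chi ξ))‖ < ε := by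
  have h := CharSpace.eventually_exists_norm_sub_lt p
    (fun (ξ : J) n => N • (f ξ n - chi (ξ : Idx κ))) (fun a ha c => by
      by_contra hcon
      rw [← Ultrafilter.eventually_not] at hcon
      push Not at hcon
      have h0 := eq_zero_of_eventually_sum_smul_eq hli (fun ξ : J => (ξ : Idx κ))
        Subtype.val_injective (fun ξ => hJ ξ ξ.2) (fun ξ => (a ξ : ℚ) * N)
        (c + ∑ ξ : J, ((a ξ : ℚ) * N) • chi (ξ : Idx κ)) (by
          filter_upwards [hcon] with n hn
          rw [← hn, ← Finset.sum_add_distrib]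
          refine Finset.sum_congr rfl fun ξ _ => ?_
          rw [← Int.cast_smul_eq_zsmul ℚ, smul_smul, smul_sub, sub_add_cancel])
      refine ha (funext fun ξ => ?_)
      simpa [hN] using congrFun h0 ξ) 0 hε hU hne
  filter_upwards [h] with n ⟨x, hx, hxn⟩
  exact ⟨x, hx, fun ξ hξ => by simpa using hxn ⟨ξ, hξ⟩⟩

/-- The countable part of the construction: a character of `G` that satisfies the limit conditions
for countably many `ξ ∈ I`, does not vanish at `d`, and takes on `B` arbitrarily late values far
from the limit at a nontrivial combination of the `f μ`. -/
theorem exists_addMonoidHom_tendsto_sequence {κ : Cardinal.{u}} {p : Ultrafilter ℕ}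
    (hp : IsSelective p) {f : Idx κ → ℕ → DirectSumQ κ} {I : Set (Idx κ)}
    (hli : LinearIndependent ℚ (basisFamily p f I)) (e : ℕ → Idx κ) (he : ∀ i, e i ∈ I)
    {d : DirectSumQ κ} (hd : d ≠ 0) {D : Finset (Idx κ)} (hD : D.Nonempty)
    (hDI : ∀ μ ∈ D, μ ∈ I) {r : Idx κ → ℚ} (hr : ∀ μ ∈ D, r μ ≠ 0) {B : Set ℕ} (hB : B ∈ p) :
    ∃ φ : DirectSumQ κ →+ UnitAddCircle, φ d ≠ 0 ∧
      (∀ i, ∀ N : ℕ, 0 < N → Tendsto (fun n => φ ((1 / (N : ℚ)) • (f (e i) n - chi (e i))))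
        (p : Filter ℕ) (𝓝 0)) ∧
      ∀ k, ∃ b ∈ B, k ≤ b ∧ 1 / 4 < ‖φ (∑ μ ∈ D, r μ • (f μ b - chi μ))‖ := by
  classical
  set W : ℕ → ℕ → Set (CharSpace (DirectSumQ κ)) := fun k n =>
    {x | ∀ i ≤ k, ∀ N ≤ k, 0 < N →
      ‖x.toHom ((1 / (N : ℚ)) • (f (e i) n - chi (e i)))‖ < 1 / ((k : ℝ) + 1)} with hW
  set V : ℕ → Set (CharSpace (DirectSumQ κ)) := fun k =>
    {x | ∃ b ∈ B, k ≤ b ∧ 1 / 4 < ‖x.toHom (∑ μ ∈ D, r μ • (f μ b - chi μ))‖} with hV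
  have hWo : ∀ k n, IsOpen (W k n) := by
    intro k n
    have : W k n = ⋂ i ∈ Set.Iic k, ⋂ N ∈ Set.Iic k ∩ {N | 0 < N}, {x |
        ‖x.toHom ((1 / (N : ℚ)) • (f (e i) n - chi (e i)))‖ < 1 / ((k : ℝ) + 1)} := by
      ext x
      simp only [hW, Set.mem_ofPred_eq, Set.mem_iInter, Set.mem_Iic, Set.mem_inter_iff, and_imp]
    rw [this]
    refine (Set.finite_Iic k).isOpen_biInter fun i _ =>
      ((Set.finite_Iic k).inter_of_left _).isOpen_biInter fun N _ =>
        isOpen_lt (CharSpace.continuous_toHom_apply _).norm continuous_const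
  have hWanti : ∀ n, Antitone fun k => W k n := by
    intro n k l hkl x hx i hi N hN hN0
    refine (hx i (hi.trans hkl) N (hN.trans hkl) hN0).trans_le ?_
    have : (k : ℝ) ≤ l := by exact_mod_cast hkl
    exact one_div_le_one_div_of_le (by positivity) (by linarith)
  have hWne : ∀ k (U : Set (CharSpace (DirectSumQ κ))), IsOpen U → U.Nonempty →
      ∀ᶠ n in (p : Filter ℕ), (U ∩ W k n).Nonempty := by
    intro k U hU hne
    -- The common denominator `k !` takes care of all the denominators up to `k`.
    have hfac : (0 : ℝ) < k.factorial := by exact_mod_cast k.factorial_pos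
    have hfacq : (0 : ℚ) < k.factorial := by exact_mod_cast k.factorial_pos
    have h := eventually_exists_norm_smul_sub_chi_lt hli
      (J := (Finset.range (k + 1)).image e) (by
        intro ξ hξ
        obtain ⟨i, -, rfl⟩ := Finset.mem_image.1 hξ
        exact he i) (one_div_ne_zero hfacq.ne')
      (ε := 1 / ((k : ℝ) + 1) / k.factorial) (by positivity) hU hne
    filter_upwards [h] with n ⟨x, hxU, hx⟩
    refine ⟨x, hxU, fun i hi N hN hN0 => ?_⟩
    obtain ⟨m, hm⟩ := Nat.dvd_factorial hN0 hN
    have hx' := hx (e i) (Finset.mem_image_of_mem e (Finset.mem_range.2 (by omega)))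
    have hNm : (1 / (N : ℚ)) • (f (e i) n - chi (e i)) =
        m • ((1 / (k.factorial : ℚ)) • (f (e i) n - chi (e i))) := by
      rw [← Nat.cast_smul_eq_nsmul ℚ, smul_smul]
      congr 1
      rw [hm]
      rw [hm] at hfacq
      push_cast at hfacq ⊢
      have h1 : (m : ℚ) ≠ 0 := fun h0 => by simp [h0] at hfacq
      have h2 : (N : ℚ) ≠ 0 := by exact_mod_cast hN0.ne'
      field_simp
    have hmk : (m : ℝ) ≤ k.factorial := by
      exact_mod_cast Nat.le_of_dvd k.factorial_pos ⟨N, by rw [hm, mul_comm]⟩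
    rw [hNm, map_nsmul]
    calc _ ≤ m * ‖x.toHom ((1 / (k.factorial : ℚ)) • (f (e i) n - chi (e i)))‖ :=
          norm_nsmul_le
      _ ≤ k.factorial * ‖x.toHom ((1 / (k.factorial : ℚ)) • (f (e i) n - chi (e i)))‖ :=
          mul_le_mul_of_nonneg_right hmk (norm_nonneg _)
      _ < 1 / ((k : ℝ) + 1) := by rwa [lt_div_iff₀' hfac] at hx'
  have hVo : ∀ k, IsOpen (V k) := by
    intro k
    have : V k = ⋃ b ∈ B ∩ Set.Ici k,
        {x | 1 / 4 < ‖x.toHom (∑ μ ∈ D, r μ • (f μ b - chi μ))‖} := by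
      ext x
      simp [hV, and_assoc]
    rw [this]
    exact isOpen_biUnion fun b _ =>
      isOpen_lt continuous_const (CharSpace.continuous_toHom_apply _).norm
  have hVd : ∀ k, Dense (V k) := by
    intro k
    refine dense_iff_inter_open.2 fun U hU hne => ?_
    have h := CharSpace.eventually_exists_norm_sub_lt p
      (fun (_ : Unit) n => ∑ μ ∈ D, r μ • (f μ n - chi μ)) (fun a ha c => by
        by_contra hcon
        rw [← Ultrafilter.eventually_not] at hcon
        push Not at hcon
        have ha' : (a () : ℚ) ≠ 0 := by
          intro h0
          exact ha (funext fun _ => by exact_mod_cast h0)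
        obtain ⟨μ₀, hμ₀⟩ := hD
        have h0 := eq_zero_of_eventually_sum_smul_eq hli (fun ξ : D => (ξ : Idx κ))
          Subtype.val_injective (fun ξ => hDI ξ ξ.2) (fun ξ => r ξ)
          ((a () : ℚ)⁻¹ • c + ∑ ξ ∈ D, r ξ • chi ξ) (by
            filter_upwards [hcon] with n hn
            rw [Fintype.sum_unique (ι := Unit), ← Int.cast_smul_eq_zsmul ℚ] at hn
            rw [← hn]
            change _ = (a () : ℚ)⁻¹ • (a () : ℚ) • _ + _
            rw [inv_smul_smul₀ ha', ← Finset.sum_add_distrib,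
              Finset.sum_coe_sort D fun ξ => r ξ • f ξ n]
            exact Finset.sum_congr rfl fun ξ _ => by rw [smul_sub, sub_add_cancel])
        exact hr μ₀ hμ₀ (congrFun h0 ⟨μ₀, hμ₀⟩))
      (fun _ => ((1 / 2 : ℝ) : UnitAddCircle)) (ε := 1 / 4) (by norm_num) hU hne
    have hIci : Set.Ici k ∈ (p : Filter ℕ) := hp.1 (by
      rw [Nat.cofinite_eq_atTop]
      exact Ici_mem_atTop k)
    obtain ⟨b, ⟨x, hxU, hx⟩, hbB, hbk⟩ := (h.and (Filter.eventually_mem_set.2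
      (inter_mem hB hIci))).exists
    refine ⟨x, hxU, b, hbB, hbk, ?_⟩
    have h1 : ‖((1 / 2 : ℝ) : UnitAddCircle)‖ = 1 / 2 := by
      have := AddCircle.norm_half_period_eq (p := (1 : ℝ))
      simpa using this
    have h2 := norm_sub_norm_le ((1 / 2 : ℝ) : UnitAddCircle)
      (x.toHom (∑ μ ∈ D, r μ • (f μ b - chi μ)))
    rw [norm_sub_rev, h1] at h2
    have h3 := hx ()
    linarith
  obtain ⟨φ₀, hφ₀⟩ := exists_addMonoidHom_apply_ne_zero hd
  obtain ⟨x, hxd, hxV, hxW⟩ := hp.exists_forall_eventually_mem W hWo hWanti hWne V hVo hVd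
    (U₀ := {x | x.toHom d ≠ 0})
    (isOpen_ne_fun (CharSpace.continuous_toHom_apply d) continuous_const)
    ⟨CharSpace.ofHom φ₀, hφ₀⟩
  refine ⟨x.toHom, hxd, fun i N hN => ?_, hxV⟩
  rw [Metric.tendsto_nhds]
  intro ε hε
  obtain ⟨k, hk⟩ := exists_nat_one_div_lt hε
  filter_upwards [hxW (max k (max i N))] with n hn
  rw [dist_zero_right]
  refine (hn i (by simp) N (by simp) hN).trans_le (le_trans ?_ hk.le)
  refine one_div_le_one_div_of_le (by positivity) ?_
  have : (k : ℝ) ≤ (max k (max i N) : ℕ) := by exact_mod_cast le_max_left _ _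
  linarith

/-! ### Extension to all coordinates -/

/-- Every countable set of indices is contained in a countable one that with `ξ` contains the
supports of all the terms of `f ξ`. -/
lemma exists_countable_support_closed {α : Type*} (f : α → ℕ → (α →₀ ℚ)) {S : Set α}
    (hS : S.Countable) : ∃ E : Set α, E.Countable ∧ S ⊆ E ∧
      ∀ ξ ∈ E, ∀ n, ((f ξ n).support : Set α) ⊆ E := by
  set T : ℕ → Set α := fun k =>
    Nat.rec S (fun _ A => ⋃ ξ ∈ A, ⋃ n, ((f ξ n).support : Set α)) k with hT
  have hTs : ∀ k, T (k + 1) = ⋃ ξ ∈ T k, ⋃ n, ((f ξ n).support : Set α) := fun k => rfl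
  refine ⟨⋃ k, T k, Set.countable_iUnion fun k => ?_, Set.subset_iUnion T 0, fun ξ hξ n μ hμ => ?_⟩
  · induction k with
    | zero => exact hS
    | succ k ih =>
      rw [hTs]
      exact ih.biUnion fun ξ _ => Set.countable_iUnion fun n => (f ξ n).support.countable_toSet
  · obtain ⟨k, hk⟩ := Set.mem_iUnion.1 hξ
    refine Set.mem_iUnion.2 ⟨k + 1, ?_⟩
    rw [hTs]
    exact Set.mem_iUnion₂.2 ⟨ξ, hk, Set.mem_iUnion.2 ⟨n, hμ⟩⟩

/-- Homomorphisms `ℚ → ℝ/ℤ` have pointwise limits along ultrafilters. -/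
lemma exists_addMonoidHom_tendsto (p : Ultrafilter ℕ) (θ : ℕ → ℚ →+ UnitAddCircle) :
    ∃ h : ℚ →+ UnitAddCircle, ∀ q, Tendsto (fun n => θ n q) (p : Filter ℕ) (𝓝 (h q)) := by
  have hex : ∀ q, ∃ y, Tendsto (fun n => θ n q) (p : Filter ℕ) (𝓝 y) := fun q =>
    ⟨(p.map fun n => θ n q).lim, (p.map fun n => θ n q).le_nhds_lim⟩
  choose h hh using hex
  refine ⟨AddMonoidHom.mk' h fun a b => ?_, hh⟩
  refine tendsto_nhds_unique (hh (a + b)) ?_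
  simpa only [map_add] using (hh a).add (hh b)

/-- Extension by transfinite recursion: a character is kept on the coordinates in `E`, and at
`ξ ∉ E` it is given the value that the limit along `p` of the `f ξ n` forces, which only involves
coordinates below `ξ`. -/
theorem exists_addMonoidHom_extension {α : Type*} [LinearOrder α] [WellFoundedLT α]
    (E I : Set α) (f : α → ℕ → (α →₀ ℚ)) (hf : ∀ ξ ∈ I, ∀ n, ∀ μ ∈ (f ξ n).support, μ < ξ)
    (p : Ultrafilter ℕ) (ψ : (α →₀ ℚ) →+ UnitAddCircle) :
    ∃ φ : (α →₀ ℚ) →+ UnitAddCircle, (∀ v : α →₀ ℚ, (v.support : Set α) ⊆ E → φ v = ψ v) ∧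
      ∀ ξ ∈ I, ξ ∉ E → ∀ q : ℚ,
        Tendsto (fun n => φ (q • f ξ n)) (p : Filter ℕ) (𝓝 (φ (Finsupp.single ξ q))) := by
  classical
  choose L hL using exists_addMonoidHom_tendsto p
  let T (h : α → ℚ →+ UnitAddCircle) (ξ : α) : ℚ →+ UnitAddCircle :=
    if ξ ∈ E then ψ.comp (Finsupp.singleAddHom ξ) else
      L fun n => (Finsupp.liftAddHom h).comp (LinearMap.toSpanSingleton ℚ _ (f ξ n)).toAddMonoidHom
  let F (ξ : α) (k : ∀ μ, μ < ξ → ℚ →+ UnitAddCircle) : ℚ →+ UnitAddCircle :=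
    T (fun μ => if hμ : μ < ξ then k μ hμ else 0) ξ
  set h : α → ℚ →+ UnitAddCircle := (wellFounded_lt (α := α)).fix F with hh
  have hfix : ∀ ξ, h ξ = T (fun μ => if μ < ξ then h μ else 0) ξ := by
    intro ξ
    rw [hh, WellFounded.fix_eq]
    simp only [F, dite_eq_ite]
  refine ⟨Finsupp.liftAddHom h, fun v hv => ?_, fun ξ hξ hξE q => ?_⟩
  · conv_rhs => rw [← Finsupp.sum_single v]
    rw [Finsupp.liftAddHom_apply, Finsupp.sum, Finsupp.sum, map_sum]
    refine Finset.sum_congr rfl fun μ hμ => ?_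
    rw [hfix]
    simp only [T]
    rw [if_pos (hv hμ)]
    rfl
  · have h1 := hL (fun n => (Finsupp.liftAddHom fun μ => if μ < ξ then h μ else 0).comp
      (LinearMap.toSpanSingleton ℚ _ (f ξ n)).toAddMonoidHom) q
    have h2 : h ξ = L fun n => (Finsupp.liftAddHom fun μ => if μ < ξ then h μ else 0).comp
        (LinearMap.toSpanSingleton ℚ _ (f ξ n)).toAddMonoidHom := by
      rw [hfix]
      simp only [T]
      rw [if_neg hξE]
    rw [← h2] at h1
    rw [Finsupp.liftAddHom_apply_single]
    refine h1.congr fun n => ?_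
    simp only [AddMonoidHom.comp_apply, LinearMap.toAddMonoidHom_coe,
      LinearMap.toSpanSingleton_apply, Finsupp.liftAddHom_apply]
    refine Finset.sum_congr rfl fun μ hμ => ?_
    simp only
    rw [if_pos (hf ξ hξ n μ (Finsupp.support_smul hμ))]

theorem mainTheorem4 (κ : Cardinal.{u}) (hκ : ℵ₀ ≤ κ) (hκω : κ ^ ℵ₀ = κ)
    (f : Idx κ → ℕ → DirectSumQ κ) (hf : IsGoodEnumeration f)
    (p : Ultrafilter ℕ) (hp : IsSelective p)
    (I : Set (Idx κ)) (hI : ∀ ξ ∈ I, Ordinal.omega0 ≤ ξ.1)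
    (hli : LinearIndependent ℚ (basisFamily p f I))
    (hspan : Submodule.span ℚ (Set.range (basisFamily p f I)) = ⊤)
    (d : DirectSumQ κ) (hd : d ≠ 0)
    (D : Finset (Idx κ)) (hD : D.Nonempty) (hDI : ∀ μ ∈ D, μ ∈ I)
    (r : Idx κ → ℚ) (hr : ∀ μ ∈ D, r μ ≠ 0)
    (B : Set ℕ) (hB : B ∈ p) :
    ∃ φ : DirectSumQ κ →+ UnitAddCircle,
      φ d ≠ 0 ∧
      (∀ ξ ∈ I, ∀ N : ℕ, 0 < N →
        Tendsto (fun n : ℕ => φ ((1 / (N : ℚ)) • f ξ n)) (p : Filter ℕ)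
          (𝓝 (φ ((1 / (N : ℚ)) • chi ξ)))) ∧
      ¬ ∃ x : UnitAddCircle,
        Tendsto (fun n : ℕ => φ (∑ μ ∈ D, r μ • f μ n)) (atTop ⊓ 𝓟 B) (𝓝 x) := by
  classical
  obtain ⟨E, hEc, hSE, hE⟩ := exists_countable_support_closed f
    (d.support.countable_toSet.union D.countable_toSet)
  obtain ⟨μ₀, hμ₀⟩ := hD
  obtain ⟨e, he⟩ := (hEc.mono (Set.inter_subset_right (s := I))).exists_eq_range
    ⟨μ₀, hDI μ₀ hμ₀, hSE (Or.inr hμ₀)⟩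
  obtain ⟨ψ, hψd, hψlim, hψB⟩ := exists_addMonoidHom_tendsto_sequence hp hli e
    (fun i => ((Set.ext_iff.1 he (e i)).2 ⟨i, rfl⟩).1) hd ⟨μ₀, hμ₀⟩ hDI hr hB
  obtain ⟨φ, hφψ, hφlim⟩ := exists_addMonoidHom_extension E I f
    (fun ξ hξ n μ hμ => hf.2 ξ (hI ξ hξ) n μ hμ) p ψ
  have hchi : ∀ ξ ∈ E, ∀ q : ℚ, ((q • chi ξ : DirectSumQ κ).support : Set (Idx κ)) ⊆ E := by
    intro ξ hξ q μ hμ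
    have h1 := Finsupp.support_single_subset (Finsupp.support_smul hμ)
    rw [Finset.mem_singleton] at h1
    exact h1 ▸ hξ
  have hfE : ∀ ξ ∈ E, ∀ (q : ℚ) (n : ℕ), ((q • f ξ n).support : Set (Idx κ)) ⊆ E :=
    fun ξ hξ q n μ hμ => hE ξ hξ n (Finsupp.support_smul hμ)
  have hdiff : ∀ ξ ∈ E, ∀ (q : ℚ) (n : ℕ), φ (q • (f ξ n - chi ξ)) = ψ (q • (f ξ n - chi ξ)) := by
    intro ξ hξ q n
    rw [smul_sub, map_sub, map_sub, hφψ _ (hfE ξ hξ q n), hφψ _ (hchi ξ hξ q)]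
  have hlim : ∀ ξ ∈ I, ξ ∈ E → ∀ N : ℕ, 0 < N →
      Tendsto (fun n => φ ((1 / (N : ℚ)) • (f ξ n - chi ξ))) (p : Filter ℕ) (𝓝 0) := by
    intro ξ hξI hξ N hN
    obtain ⟨i, rfl⟩ := (Set.ext_iff.1 he ξ).1 ⟨hξI, hξ⟩
    exact (hψlim i N hN).congr fun n => (hdiff _ hξ _ n).symm
  refine ⟨φ, ?_, fun ξ hξ N hN => ?_, ?_⟩
  · rw [hφψ d fun μ hμ => hSE (Or.inl hμ)]
    exact hψd
  · by_cases hξE : ξ ∈ E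
    · have h1 := (hlim ξ hξ hξE N hN).add_const (φ ((1 / (N : ℚ)) • chi ξ))
      rw [zero_add] at h1
      refine h1.congr fun n => ?_
      rw [← map_add, smul_sub, sub_add_cancel]
    · have h1 := hφlim ξ hξ hξE (1 / (N : ℚ))
      rwa [show (Finsupp.single ξ (1 / (N : ℚ)) : DirectSumQ κ) = (1 / (N : ℚ)) • chi ξ by
        simp [chi]] at h1
  · rintro ⟨x, hx⟩
    have hsplit : ∀ n, φ (∑ μ ∈ D, r μ • f μ n) =
        φ (∑ μ ∈ D, r μ • (f μ n - chi μ)) + φ (∑ μ ∈ D, r μ • chi μ) := by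
      intro n
      rw [← map_add, ← Finset.sum_add_distrib]
      congr 1
      exact Finset.sum_congr rfl fun μ _ => by rw [smul_sub, sub_add_cancel]
    have hp0 : Tendsto (fun n => φ (∑ μ ∈ D, r μ • (f μ n - chi μ))) (p : Filter ℕ) (𝓝 0) := by
      simp only [map_sum]
      rw [← Finset.sum_const_zero (s := D)]
      refine tendsto_finsetSum D fun μ hμ => ?_
      have h1 := (hlim μ (hDI μ hμ) (hSE (Or.inr hμ)) (r μ).den (r μ).den_pos).const_smul (r μ).num
      rw [smul_zero] at h1
      refine h1.congr fun n => ?_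
      rw [← map_zsmul, ← Int.cast_smul_eq_zsmul ℚ, smul_smul, mul_one_div, Rat.num_div_den]
    -- Both the limit along `B` and the limit along `p` exist, so they agree.
    have hple : (p : Filter ℕ) ≤ atTop ⊓ 𝓟 B :=
      le_inf (Nat.cofinite_eq_atTop ▸ hp.1) (Filter.le_principal_iff.2 hB)
    have hB0 : Tendsto (fun n => φ (∑ μ ∈ D, r μ • (f μ n - chi μ))) (atTop ⊓ 𝓟 B) (𝓝 0) := by
      have h1 : Tendsto (fun n => φ (∑ μ ∈ D, r μ • (f μ n - chi μ))) (atTop ⊓ 𝓟 B)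
          (𝓝 (x - φ (∑ μ ∈ D, r μ • chi μ))) :=
        (hx.sub_const _).congr fun n => by rw [hsplit, add_sub_cancel_right]
      rwa [tendsto_nhds_unique (h1.mono_left hple) hp0] at h1
    have hev := Metric.tendsto_nhds.1 hB0 (1 / 4) (by norm_num)
    rw [Filter.eventually_inf_principal, Filter.eventually_atTop] at hev
    obtain ⟨k, hk⟩ := hev
    obtain ⟨b, hbB, hkb, hb⟩ := hψB k
    have h1 := hk b hkb hbB
    rw [dist_zero_right, map_sum, Finset.sum_congr rfl fun μ hμ => hdiff μ (hSE (Or.inr hμ)) _ b,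
      ← map_sum] at h1
    exact lt_asymm hb h1
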